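/- Let $d\ge 1$. For $\alpha,\beta\in\mathbb N^d$ let $\alpha\wedge\beta$ be the componentwise minimum, put $I=\{1,\dots,d\}$, and write $\alpha\ll\beta$ if $\alpha_i<\beta_i$ for all $i\in I$. A submonoid $S$ of $(\mathbb N^d,+)$ is a \emph{good semigroup} if (G1) $\alpha\wedge\beta\in S$ for all $\alpha,\beta\in S$; (G2) if $\alpha,\beta\in S$, $\alpha\ne\beta$ and $\alpha_i=\beta_i$ for some $i$, then there is $\epsilon\in S$ with $\epsilon_i>\alpha_i$ and, for every $j\neq i$, $\epsilon_j\ge\min\{\alpha_j,\beta_j\}$, with equality if $\alpha_j\ne\beta_j$; (G3) there is $c\in S$ with $c+\mathbb N^d\subseteq S$. A \emph{good ideal} of $S$ is a set $E\subseteq S$ with $E+S\subseteq E$ that satisfies (G1), (G2) and (G3) (with $E$ in place of $S$). Let $c_E$ be the least $c\in\mathbb N^d$ with $c+\mathbb N^d\subseteq E$, and let $\gamma_E=c_E-(1,\dots,1)\in\mathbb Z^d$. For $\alpha\in\mathbb Z^d$ and $F\subseteq I$ let $$\Delta^S_F(\alpha)=\{\beta\in S:\ \beta_i=\alpha_i\text{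 for } i\in F,\ \beta_j>\alpha_j\text{ for } j\notin F\},\qquad \Delta^S(\alpha)=\bigcup_{i=1}^d\Delta^S_{\{i\}}(\alpha).$$ Let $A=S\setminus E$. Say that $\alpha$ is a \emph{complete infimum} of $\beta^{(1)},\dots,\beta^{(r)}$, $r\ge2$, if there are nonempty proper subsets $F_1,\dots,F_r$ of $I$ with $\beta^{(k)}\in\Delta^S_{F_k}(\alpha)$ for all $k$, $\beta^{(j)}\wedge\beta^{(k)}=\alpha$ for all $j\ne k$, and $\bigcap_k F_k=\emptyset$. For $i\ge1$ define inductively: $B^{(i)}$ is the set of those elements $\alpha$ of $A\setminus\bigcup_{j<i}D^{(j)}$ for which no element $\beta$ of this set satisfies $\alpha\ll\beta$; $C^{(i)}$ is the set of elements of $B^{(i)}$ that are complete infima of $r$ elements of $B^{(i)}$ for some $r$ with $1<r\le d$; and $D^{(i)}=B^{(i)}\setminus C^{(i)}$. Let $N\ge1$ be the least integer with $A=\bigcup_{i=1}^N D^{(i)}$ (such an integer exists). The \emph{levels} of $A$ are the sets $A_i=D^{(N+1-i)}$, $1\le i\le N$. The \emph{dual levels} are $$A_i'=\Big(\bigcup_{\omega\in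 A_i}\Delta^S(\gamma_E-\omega)\Big)\setminus\Big(\bigcup_{1\le j<i}\ \bigcup_{\omega\in A_j}\Delta^S(\gamma_E-\omega)\Big).$$ $A$ is a \emph{symmetric complement} of $E$ if $A_1=\{0\}$ and, for all $\alpha\in\mathbb N^d$: (i) $\alpha\in E$ if and only if $\Delta^S(\gamma_E-\alpha)=\emptyset$; (ii) $\alpha\in A$ if and only if $\Delta^S(\gamma_E-\alpha)$ is nonempty and contained in $A$. \textbf{Theorem.} Let $S\subseteq\mathbb N^d$ be a good semigroup, let $E\subseteq S$ be a good ideal, and let $A=S\setminus E=\bigcup_{i=1}^N A_i$. If $A$ is a symmetric complement of $E$, then $A_i'=A_{N-i+1}$ for every $i=1,\dots,N$. -/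

import Mathlib

namespace GoodSemigroup

/-! Subsets of `ℕ ^ d` are sets of functions `Fin d → ℕ`, with the componentwise order and sum;
the infimum `a ⊓ b` is the componentwise minimum. -/

/-- Properties (G1), (G2), (G3) of a subset `X` of `ℕ ^ d`. -/
structure HasGoodProperties {d : ℕ} (X : Set (Fin d → ℕ)) : Prop where
  inf_mem : ∀ a ∈ X, ∀ b ∈ X, a ⊓ b ∈ X
  exists_lt : ∀ a ∈ X, ∀ b ∈ X, a ≠ b → ∀ i, a i = b i →
    ∃ e ∈ X, a i < e i ∧
      ∀ j, j ≠ i → min (a j) (b j) ≤ e j ∧ (a j ≠ b j → e j = min (a j) (b j))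
  exists_cone : ∃ c ∈ X, ∀ x, c + x ∈ X

/-- A good semigroup is a submonoid of `ℕ ^ d` satisfying (G1), (G2), (G3). -/
def IsGoodSemigroup {d : ℕ} (S : AddSubmonoid (Fin d → ℕ)) : Prop :=
  HasGoodProperties (S : Set (Fin d → ℕ))

/-- `E` is a relative ideal of `S`: `E + S ⊆ E`, and `a + E ⊆ S` for some `a ∈ S`. -/
structure IsRelativeIdeal {d : ℕ} (S : AddSubmonoid (Fin d → ℕ)) (E : Set (Fin d → ℕ)) :
    Prop where
  add_mem : ∀ e ∈ E, ∀ s ∈ S, e + s ∈ E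
  exists_add_mem : ∃ a ∈ S, ∀ e ∈ E, a + e ∈ S

/-- A good ideal of `S` is a relative ideal contained in `S` that satisfies (G1), (G2), (G3). -/
structure IsGoodIdeal {d : ℕ} (S : AddSubmonoid (Fin d → ℕ)) (E : Set (Fin d → ℕ)) :
    Prop extends IsRelativeIdeal S E where
  subset : E ⊆ (S : Set (Fin d → ℕ))
  good : HasGoodProperties E

/-- The conductor of `X`: the minimum of all `a` with `a + ℕ ^ d ⊆ X`, formed componentwise; it is
the least such `a` by `conductor_isLeast`. -/
noncomputable def conductor {d : ℕ} (X : Set (Fin d → ℕ)) : Fin d → ℕ :=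
  sInf {a | ∀ x, a + x ∈ X}

theorem conductor_isLeast {d : ℕ} {X : Set (Fin d → ℕ)} (hX : HasGoodProperties X) :
    IsLeast {a : Fin d → ℕ | ∀ x, a + x ∈ X} (conductor X) := by
  have hne : {a : Fin d → ℕ | ∀ x, a + x ∈ X}.Nonempty := by
    obtain ⟨c, -, hc⟩ := hX.exists_cone
    exact ⟨c, hc⟩
  have happ : ∀ i, conductor X i = sInf ((fun a : Fin d → ℕ => a i) '' {a | ∀ x, a + x ∈ X}) := by
    intro i
    rw [conductor, sInf_apply, sInf_image']
  have hlow : ∀ a ∈ {a : Fin d → ℕ | ∀ x, a + x ∈ X}, conductor X ≤ a := by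
    intro a ha i
    rw [happ]
    exact Nat.sInf_le ⟨a, ha, rfl⟩
  have hatt : ∀ i, ∃ a : Fin d → ℕ, (∀ x, a + x ∈ X) ∧ a i = conductor X i := by
    intro i
    rw [happ]
    obtain ⟨a, ha, hai⟩ := Nat.sInf_mem (hne.image fun a : Fin d → ℕ => a i)
    exact ⟨a, ha, hai⟩
  refine ⟨?_, hlow⟩
  have key : ∀ s : Finset (Fin d), ∃ a : Fin d → ℕ,
      (∀ x, a + x ∈ X) ∧ ∀ i ∈ s, a i = conductor X i := by
    intro s
    induction s using Finset.induction_on with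
    | empty => exact ⟨hne.some, hne.some_mem, by simp⟩
    | insert i s _ ih =>
      obtain ⟨a, ha, has⟩ := ih
      obtain ⟨b, hb, hbi⟩ := hatt i
      refine ⟨a ⊓ b, fun x => ?_, ?_⟩
      · have h3 := ha (fun j => (a ⊓ b) j + x j - a j)
        have h4 := hb (fun j => (a ⊓ b) j + x j - b j)
        convert hX.inf_mem _ h3 _ h4 using 1
        funext j
        simp only [Pi.add_apply, Pi.inf_apply]
        omega
      · intro j hj
        have hja : conductor X j ≤ a j := hlow a ha j
        have hjb : conductor X j ≤ b j := hlow b hb j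
        change min (a j) (b j) = conductor X j
        rcases Finset.mem_insert.1 hj with rfl | hj
        · omega
        · have := has j hj
          omega
  obtain ⟨a, ha, hac⟩ := key Finset.univ
  have : a = conductor X := funext fun i => hac i (Finset.mem_univ i)
  exact this ▸ ha

/-- `γ_X = c_X - (1, …, 1)`, as a vector of integers. -/
noncomputable def gamma {d : ℕ} (X : Set (Fin d → ℕ)) : Fin d → ℤ :=
  fun i => (conductor X i : ℤ) - 1

/-- A vector of natural numbers, seen in `ℤ ^ d`. -/
def toInt {d : ℕ} (a : Fin d → ℕ) : Fin d → ℤ := fun i => (a i : ℤ)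

/-- `Δ^X_F(a)`, for `a ∈ ℤ ^ d` and a set `F` of indices. -/
def deltaF {d : ℕ} (X : Set (Fin d → ℕ)) (F : Set (Fin d)) (a : Fin d → ℤ) :
    Set (Fin d → ℕ) :=
  {b | b ∈ X ∧ (∀ i ∈ F, (b i : ℤ) = a i) ∧ ∀ j ∉ F, a j < (b j : ℤ)}

/-- `Δ^X(a)`, the union over all indices `i` of `Δ^X_i(a)`. -/
def delta {d : ℕ} (X : Set (Fin d → ℕ)) (a : Fin d → ℤ) : Set (Fin d → ℕ) :=
  ⋃ i, deltaF X {i} a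

/-- `a` is the complete infimum of `b 1, …, b r` (for `r ≥ 2`). -/
def IsCompleteInf {d : ℕ} (S : AddSubmonoid (Fin d → ℕ)) {r : ℕ} (b : Fin r → Fin d → ℕ)
    (a : Fin d → ℕ) : Prop :=
  2 ≤ r ∧ ∃ F : Fin r → Set (Fin d),
    (∀ k, (F k).Nonempty ∧ F k ≠ Set.univ ∧ b k ∈ deltaF (S : Set (Fin d → ℕ)) (F k) (toInt a)) ∧
    (∀ j k, j ≠ k → a = b j ⊓ b k) ∧ ⋂ k, F k = ∅

/-- The order `≤≤`: `a = b`, or `b` is strictly larger than `a` in every component. -/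
def DomLE {d : ℕ} (a b : Fin d → ℕ) : Prop := a = b ∨ ∀ i, a i < b i

/-- The elements of `X` that are maximal with respect to `≤≤`. -/
def maxPart {d : ℕ} (X : Set (Fin d → ℕ)) : Set (Fin d → ℕ) :=
  {a | a ∈ X ∧ ∀ b ∈ X, DomLE a b → a = b}

/-- The elements of `maxPart X` that are complete infima of at most `d` elements of `maxPart X`. -/
def infPart {d : ℕ} (S : AddSubmonoid (Fin d → ℕ)) (X : Set (Fin d → ℕ)) :
    Set (Fin d → ℕ) :=
  {a | a ∈ maxPart X ∧ ∃ r, 1 < r ∧ r ≤ d ∧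
    ∃ b : Fin r → Fin d → ℕ, (∀ k, b k ∈ maxPart X) ∧ IsCompleteInf S b a}

/-- What is left of `A` after the removal of the first `n` layers `D⁽¹⁾, …, D⁽ⁿ⁾`. -/
def residual {d : ℕ} (S : AddSubmonoid (Fin d → ℕ)) (A : Set (Fin d → ℕ)) :
    ℕ → Set (Fin d → ℕ)
  | 0 => A
  | n + 1 => residual S A n \ (maxPart (residual S A n) \ infPart S (residual S A n))

/-- The layer `D⁽ⁱ⁾ = B⁽ⁱ⁾ \ C⁽ⁱ⁾` of `A`, for `i ≥ 1`. -/
def layer {d : ℕ} (S : AddSubmonoid (Fin d → ℕ)) (A : Set (Fin d → ℕ)) (i : ℕ) :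
    Set (Fin d → ℕ) :=
  maxPart (residual S A (i - 1)) \ infPart S (residual S A (i - 1))

theorem residual_eq {d : ℕ} (S : AddSubmonoid (Fin d → ℕ)) (A : Set (Fin d → ℕ)) (n : ℕ) :
    residual S A n = A \ ⋃ j ∈ Set.Icc 1 n, layer S A j := by
  induction n with
  | zero => simp [residual]
  | succ n ih =>
    have h : residual S A (n + 1) = residual S A n \ layer S A (n + 1) := rfl
    rw [h, ih]
    ext a
    simp only [Set.mem_sdiff, Set.mem_iUnion, Set.mem_Icc, exists_prop, not_exists, not_and]
    constructor
    · rintro ⟨⟨ha, h1⟩, h2⟩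
      refine ⟨ha, fun j hj => ?_⟩
      rcases Nat.lt_or_ge n j with hjn | hjn
      · obtain rfl : j = n + 1 := by omega
        exact h2
      · exact h1 j ⟨hj.1, hjn⟩
    · rintro ⟨ha, h1⟩
      exact ⟨⟨ha, fun j hj => h1 j ⟨hj.1, by omega⟩⟩, h1 (n + 1) ⟨by omega, le_rfl⟩⟩

theorem layer_subset {d : ℕ} (S : AddSubmonoid (Fin d → ℕ)) (A : Set (Fin d → ℕ)) (i : ℕ) :
    layer S A i ⊆ A := by
  intro a ha
  have h : a ∈ residual S A (i - 1) := ha.1.1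
  rw [residual_eq] at h
  exact h.1

/-- The number `N` of levels of `A`: the least `n ≥ 1` such that `A = D⁽¹⁾ ∪ ⋯ ∪ D⁽ⁿ⁾`.
It exists if `A` is the complement of a good ideal, see `numLevels_spec`. -/
noncomputable def numLevels {d : ℕ} (S : AddSubmonoid (Fin d → ℕ)) (A : Set (Fin d → ℕ)) : ℕ :=
  sInf {n | 1 ≤ n ∧ A = ⋃ j ∈ Set.Icc 1 n, layer S A j}

theorem numLevels_spec {d : ℕ} (S : AddSubmonoid (Fin d → ℕ)) {E : Set (Fin d → ℕ)}
    (hE : IsGoodIdeal S E) :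
    IsLeast {n | 1 ≤ n ∧ (S : Set (Fin d → ℕ)) \ E =
        ⋃ j ∈ Set.Icc 1 n, layer S ((S : Set (Fin d → ℕ)) \ E) j}
      (numLevels S ((S : Set (Fin d → ℕ)) \ E)) := by
  obtain ⟨c, -, hc⟩ := hE.good.exists_cone
  set A := (S : Set (Fin d → ℕ)) \ E with hA
  have up : ∀ n, ∀ a ∈ residual S A (n + 1), ∀ j, ∃ b ∈ residual S A n, a ≤ b ∧ a j < b j := by
    intro n a ha j
    obtain ⟨ha0, ha1⟩ := ha
    by_cases hm : a ∈ maxPart (residual S A n)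
    · have hi : a ∈ infPart S (residual S A n) := by
        by_contra hi
        exact ha1 ⟨hm, hi⟩
      obtain ⟨-, r, -, -, b, hb, -, F, hF, -, hemp⟩ := hi
      have hj : j ∉ ⋂ k, F k := by rw [hemp]; exact fun h => h
      obtain ⟨k, hk⟩ : ∃ k, j ∉ F k := by simpa using hj
      obtain ⟨-, -, -, h1, h2⟩ := hF k
      have h1' : ∀ l ∈ F k, (b k l : ℤ) = (a l : ℤ) := h1
      have h2' : ∀ l ∉ F k, (a l : ℤ) < (b k l : ℤ) := h2
      refine ⟨b k, (hb k).1, fun l => ?_, by exact_mod_cast h2' j hk⟩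
      change a l ≤ b k l
      by_cases hl : l ∈ F k
      · have := h1' l hl
        omega
      · have := h2' l hl
        omega
    · have : ∃ b ∈ residual S A n, DomLE a b ∧ a ≠ b := by
        by_contra hcon
        refine hm ⟨ha0, fun b hb hab => ?_⟩
        by_contra hne
        exact hcon ⟨b, hb, hab, hne⟩
      obtain ⟨b, hb, hab, hne⟩ := this
      have hlt := hab.resolve_left hne
      exact ⟨b, hb, fun l => (hlt l).le, hlt j⟩
  have hsmall : ∀ a ∈ A, ∃ j, a j < c j := by
    intro a ha
    by_contra hcon
    push Not at hcon
    refine ha.2 ?_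
    have h := hc (a - c)
    have h' : c + (a - c) = a := by
      funext l
      have := hcon l
      simp only [Pi.add_apply, Pi.sub_apply]
      omega
    rwa [h'] at h
  have bound : ∀ n, ∀ a ∈ residual S A n, n + ∑ j, min (a j) (c j) < 1 + ∑ j, c j := by
    intro n
    induction n with
    | zero =>
      intro a _
      have : ∑ j, min (a j) (c j) ≤ ∑ j, c j :=
        Finset.sum_le_sum fun j _ => min_le_right _ _
      omega
    | succ n ih =>
      intro a ha
      have haA : a ∈ A := by
        rw [residual_eq] at ha
        exact ha.1
      obtain ⟨j, hj⟩ := hsmall a haA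
      obtain ⟨b, hb, hab, hlt⟩ := up n a ha j
      have h1 := ih b hb
      have h2 : ∑ l, min (a l) (c l) < ∑ l, min (b l) (c l) :=
        Finset.sum_lt_sum (fun l _ => min_le_min_right _ (hab l))
          ⟨j, Finset.mem_univ j, by omega⟩
      omega
  have hne : {n | 1 ≤ n ∧ A = ⋃ j ∈ Set.Icc 1 n, layer S A j}.Nonempty := by
    refine ⟨1 + ∑ j, c j, by omega, Set.Subset.antisymm (fun a ha => ?_) ?_⟩
    · by_contra hcon
      have h : a ∈ residual S A (1 + ∑ j, c j) := by
        rw [residual_eq]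
        exact ⟨ha, hcon⟩
      have := bound _ a h
      omega
    · exact Set.iUnion₂_subset fun j _ => layer_subset S A j
  exact ⟨Nat.sInf_mem hne, fun n hn => Nat.sInf_le hn⟩

/-- The level `A_i = D⁽ᴺ⁺¹⁻ⁱ⁾`, for `1 ≤ i ≤ N`, of the complement `A = S \ E`. -/
noncomputable def level {d : ℕ} (S : AddSubmonoid (Fin d → ℕ)) (E : Set (Fin d → ℕ)) (i : ℕ) :
    Set (Fin d → ℕ) :=
  layer S ((S : Set (Fin d → ℕ)) \ E) (numLevels S ((S : Set (Fin d → ℕ)) \ E) + 1 - i)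

/-- The dual level `A_i'`: the union of `Δ^S(γ_E - w)` over `w ∈ A_i`, minus the union of
`Δ^S(γ_E - w)` over all `w ∈ A_j` with `1 ≤ j < i`. -/
noncomputable def dualLevel {d : ℕ} (S : AddSubmonoid (Fin d → ℕ)) (E : Set (Fin d → ℕ)) (i : ℕ) :
    Set (Fin d → ℕ) :=
  (⋃ w ∈ level S E i, delta (S : Set (Fin d → ℕ)) (gamma E - toInt w)) \
    ⋃ j ∈ Set.Ico 1 i, ⋃ w ∈ level S E j, delta (S : Set (Fin d → ℕ)) (gamma E - toInt w)

/-- `A = S \ E` is a symmetric complement of `E`. -/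
structure IsSymmetricComplement {d : ℕ} (S : AddSubmonoid (Fin d → ℕ)) (E : Set (Fin d → ℕ)) :
    Prop where
  level_one : level S E 1 = {0}
  mem_ideal_iff : ∀ a : Fin d → ℕ,
    a ∈ E ↔ delta (S : Set (Fin d → ℕ)) (gamma E - toInt a) = ∅
  mem_compl_iff : ∀ a : Fin d → ℕ, a ∈ (S : Set (Fin d → ℕ)) \ E ↔
    delta (S : Set (Fin d → ℕ)) (gamma E - toInt a) ⊆ (S : Set (Fin d → ℕ)) \ E ∧
      (delta (S : Set (Fin d → ℕ)) (gamma E - toInt a)).Nonempty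

end GoodSemigroup

/-!
The proof expresses the levels through a length function. For `a ∈ ℕ ^ d` let `f a` be the length
of `{b ∈ S | a ≤ b}` relative to `{b ∈ E | a ≤ b}`: on a step from `a` to `a + e_i` it decreases by
the number of jumps of `S` (one if some element of `S` above `a` has `i`-th component `a_i`, zero
otherwise) minus the number of jumps of `E`. By (G2) this does not depend on the path
(`jump_add_jump_comm`).

The layer `D⁽ⁿ⁾` consists of the elements of `A = S \ E` with `f a = n` (`mem_layer_iff`). At every
`a ∈ A` there is a direction in which `E` does not jump, and then every element above `a` in that
direction has smaller length, so no element of the least remaining length is dominated or a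
complete infimum (`mem_maxPart_diff_infPart_of_eq`). Conversely, an undominated element of larger
length is a complete infimum (`mem_infPart_of_lt`). In particular the number of levels is `N = f 0`.

The condition `a ∈ E ↔ Δ(γ - a) = ∅` says that `E` and `S` are dual, and it implies that `E` jumps
from `a` to `a + e_i` exactly if `S` does not jump from `c - a - e_i` to `c - a`
(`jump_iff_not_jump`). Hence `f a + f (c - a) = N` for `a ≤ c`, where `c` is the conductor of `E`.
If `b ∈ Δ(γ - a)`, then `b` lies above some `c - a - e_i`, so `f a + f b ≤ N + 1`
(`IsRelLength.add_le`), and for each `a ∈ A` some `b` attains equality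
(`IsRelLength.exists_add_eq`). So the dual level `A_i'` is the set where `f = i`, which is the level
`A_{N - i + 1}`.
-/

namespace GoodSemigroup

/-! ### Jumps and the relative length -/

/-- `X` jumps at `a` in direction `i`: some element of `X` above `a` has the same `i`-th component
as `a`. Equivalently, the elements of `X` above `a` and those above `a + e_i` are not the same. -/
def Jump {d : ℕ} (X : Set (Fin d → ℕ)) (i : Fin d) (a : Fin d → ℕ) : Prop :=
  ∃ b ∈ X, a ≤ b ∧ b i = a i

open Classical in
/-- The number of jumps of `X` on the step from `a` to `a + e_i`, which is `0` or `1`. -/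
noncomputable def jump {d : ℕ} (X : Set (Fin d → ℕ)) (i : Fin d) (a : Fin d → ℕ) : ℤ :=
  if Jump X i a then 1 else 0

/-- `f a` is the length of `{b ∈ S | a ≤ b}` relative to `{b ∈ E | a ≤ b}`: along a path of unit
steps that starts at `a` and ends above `c`, it is the number of jumps of `S` minus the number of
jumps of `E`. It is encoded by the change of `f` on each step and by the value at `c`. -/
structure IsRelLength {d : ℕ} (S E : Set (Fin d → ℕ)) (c : Fin d → ℕ)
    (f : (Fin d → ℕ) → ℤ) : Prop where
  step : ∀ i a, f a = f (a + Pi.single i 1) + (jump S i a - jump E i a)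
  apply_conductor : f c = 0

variable {d : ℕ} {S E : Set (Fin d → ℕ)} {c : Fin d → ℕ} {f : (Fin d → ℕ) → ℤ}

/-- The term `h i`, with its type in the form that `omega` recognizes. -/
theorem apply_le_apply {a b : Fin d → ℕ} (h : a ≤ b) (i : Fin d) : a i ≤ b i := h i

theorem add_single_le_iff {a b : Fin d → ℕ} {i : Fin d} :
    a + Pi.single i 1 ≤ b ↔ a ≤ b ∧ a i < b i := by
  constructor
  · intro h
    refine ⟨fun j => le_trans (by simp) (h j), ?_⟩
    have := h i
    simp only [Pi.add_apply, Pi.single_eq_same] at this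
    omega
  · rintro ⟨h, hi⟩ j
    rcases eq_or_ne j i with rfl | hj
    · simp only [Pi.add_apply, Pi.single_eq_same]
      omega
    · simpa [hj] using h j

theorem jump_of_jump {X : Set (Fin d → ℕ)} {i : Fin d} {a : Fin d → ℕ} (h : Jump X i a) :
    jump X i a = 1 := if_pos h

theorem jump_of_not_jump {X : Set (Fin d → ℕ)} {i : Fin d} {a : Fin d → ℕ} (h : ¬ Jump X i a) :
    jump X i a = 0 := if_neg h

theorem Jump.mono {X Y : Set (Fin d → ℕ)} (hXY : X ⊆ Y) {i : Fin d} {a : Fin d → ℕ}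
    (h : Jump X i a) : Jump Y i a := by
  obtain ⟨b, hb, hab⟩ := h
  exact ⟨b, hXY hb, hab⟩

theorem Jump.of_mem {X : Set (Fin d → ℕ)} {a : Fin d → ℕ} (ha : a ∈ X) (i : Fin d) :
    Jump X i a := ⟨a, ha, le_rfl, rfl⟩

theorem Jump.of_conductor_le {X : Set (Fin d → ℕ)} (hc : ∀ x, c + x ∈ X) {i : Fin d}
    {a : Fin d → ℕ} (h : c i ≤ a i) : Jump X i a := by
  refine ⟨c + (a - c), hc _, fun j => ?_, ?_⟩ <;> simp only [Pi.add_apply, Pi.sub_apply] <;> omega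

/-- By (G1), a point at which `X` jumps in every direction is the infimum of the witnesses. -/
theorem mem_of_forall_jump {X : Set (Fin d → ℕ)} (hX : HasGoodProperties X)
    {a : Fin d → ℕ} (h : ∀ i, Jump X i a) : a ∈ X := by
  have key : ∀ s : Finset (Fin d), ∃ b ∈ X, a ≤ b ∧ ∀ i ∈ s, b i = a i := by
    intro s
    induction s using Finset.induction_on with
    | empty =>
      obtain ⟨e, -, he⟩ := hX.exists_cone
      exact ⟨e + a, he a, fun j => by simp, by simp⟩
    | insert i s _ ih =>
      obtain ⟨b, hb, hab, hs⟩ := ih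
      obtain ⟨b', hb', hab', hi⟩ := h i
      refine ⟨b ⊓ b', hX.inf_mem b hb b' hb', le_inf hab hab', fun j hj => ?_⟩
      have h1 := apply_le_apply hab j
      have h2 := apply_le_apply hab' j
      simp only [Pi.inf_apply]
      rcases Finset.mem_insert.1 hj with rfl | hj
      · omega
      · have := hs j hj
        omega
  obtain ⟨b, hb, -, h⟩ := key Finset.univ
  have : b = a := funext fun i => h i (Finset.mem_univ i)
  exact this ▸ hb

/-- The number of jumps does not depend on the order of two steps; this is where (G2) enters. -/
theorem jump_add_jump_comm {X : Set (Fin d → ℕ)} (hX : HasGoodProperties X) (i j : Fin d)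
    (a : Fin d → ℕ) :
    jump X i a + jump X j (a + Pi.single i 1) = jump X j a + jump X i (a + Pi.single j 1) := by
  rcases eq_or_ne i j with rfl | hij
  · rfl
  have weaken : ∀ k l : Fin d, k ≠ l → Jump X k (a + Pi.single l 1) → Jump X k a := by
    rintro k l hkl ⟨b, hb, hab, hk⟩
    refine ⟨b, hb, (add_single_le_iff.1 hab).1, ?_⟩
    simpa [hkl] using hk
  have strengthen : ∀ k l : Fin d, k ≠ l → Jump X k a → ¬ Jump X l a →
      Jump X k (a + Pi.single l 1) := by
    rintro k l hkl ⟨b, hb, hab, hk⟩ hl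
    refine ⟨b, hb, add_single_le_iff.2 ⟨hab, lt_of_le_of_ne (apply_le_apply hab l) fun h => ?_⟩, ?_⟩
    · exact hl ⟨b, hb, hab, h.symm⟩
    · simpa [hkl] using hk
  have swap : ∀ k l : Fin d, k ≠ l → Jump X k a → Jump X l (a + Pi.single k 1) →
      Jump X k (a + Pi.single l 1) := by
    rintro k l hkl ⟨w, hw, haw, hk⟩ ⟨b, hb, hab, hl⟩
    obtain ⟨hab, hbk⟩ := add_single_le_iff.1 hab
    replace hl : b l = a l := by simpa [hkl.symm] using hl
    rcases eq_or_lt_of_le (apply_le_apply haw l) with h | h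
    · obtain ⟨e, he, hel, hej⟩ := hX.exists_lt w hw b hb
        (by rintro rfl; omega) l (by omega)
      refine ⟨e, he, add_single_le_iff.2 ⟨fun m => ?_, by omega⟩, ?_⟩
      · change a m ≤ e m
        rcases eq_or_ne m l with rfl | hm
        · omega
        · have h1 := apply_le_apply haw m
          have h2 := apply_le_apply hab m
          have h3 := (hej m hm).1
          omega
      · have h1 := (hej k hkl).2 (by omega)
        simp only [Pi.add_apply, Pi.single_eq_of_ne hkl]
        omega
    · refine ⟨w, hw, add_single_le_iff.2 ⟨haw, h⟩, ?_⟩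
      simpa [hkl] using hk
  unfold jump
  by_cases hi : Jump X i a <;> by_cases hj : Jump X j a
  · by_cases h : Jump X i (a + Pi.single j 1)
    · rw [if_pos hi, if_pos hj, if_pos h, if_pos (swap j i hij.symm hj h)]
    · rw [if_pos hi, if_pos hj, if_neg h, if_neg fun h' => h (swap i j hij hi h')]
  · rw [if_pos hi, if_neg hj, if_neg fun h => hj (weaken j i hij.symm h),
      if_pos (strengthen i j hij hi hj)]
    rfl
  · rw [if_neg hi, if_pos hj, if_neg fun h => hi (weaken i j hij h),
      if_pos (strengthen j i hij.symm hj hi)]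
    rfl
  · rw [if_neg hi, if_neg hj, if_neg fun h => hi (weaken i j hij h),
      if_neg fun h => hj (weaken j i hij.symm h)]

open Classical in
/-- The sum of `g` over the steps of one path of length `n` that goes down from `a`. -/
noncomputable def pathSum (g : Fin d → (Fin d → ℕ) → ℤ) : ℕ → (Fin d → ℕ) → ℤ
  | 0, _ => 0
  | n + 1, a => if h : ∃ i, 0 < a i then
      pathSum g n (a - Pi.single h.choose 1) + g h.choose (a - Pi.single h.choose 1) else 0

theorem exists_eq_add_single {a : Fin d → ℕ} {i : Fin d} (h : 0 < a i) :
    a = a - Pi.single i 1 + Pi.single i 1 := by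
  funext j
  rcases eq_or_ne j i with rfl | hj
  · simp only [Pi.add_apply, Pi.sub_apply, Pi.single_eq_same]
    omega
  · simp [hj]

theorem sum_add_single (a : Fin d → ℕ) (i : Fin d) :
    ∑ j, (a + Pi.single i 1 : Fin d → ℕ) j = ∑ j, a j + 1 := by
  simp [Finset.sum_add_distrib]

/-- A function on the unit steps of `ℕ ^ d` whose sum over two steps does not depend on their order
is the increment of a function on the points. -/
theorem exists_potential (g : Fin d → (Fin d → ℕ) → ℤ)
    (hg : ∀ i j a, g i a + g j (a + Pi.single i 1) = g j a + g i (a + Pi.single j 1)) :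
    ∃ r : (Fin d → ℕ) → ℤ, ∀ i a, r (a + Pi.single i 1) = r a + g i a := by
  have hsucc : ∀ (n : ℕ) (a : Fin d → ℕ) (i : Fin d), 0 < a i → ∃ k, 0 < a k ∧
      pathSum g (n + 1) a =
        pathSum g n (a - Pi.single k 1) + g k (a - Pi.single k 1) := fun n a i hi => by
    have h : ∃ k, 0 < a k := ⟨i, hi⟩
    exact ⟨h.choose, h.choose_spec, dif_pos h⟩
  have key : ∀ n : ℕ, ∀ a : Fin d → ℕ, ∑ j, a j = n → ∀ i,
      pathSum g (n + 1) (a + Pi.single i 1) = pathSum g n a + g i a := by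
    intro n
    induction n with
    | zero =>
      intro a ha i
      obtain ⟨k, hk, h⟩ := hsucc 0 (a + Pi.single i 1) i (by simp)
      rcases eq_or_ne k i with rfl | hki
      · rw [h, add_tsub_cancel_right]
      · have h0 := Finset.sum_eq_zero_iff.1 ha k (Finset.mem_univ k)
        simp only [Pi.add_apply, Pi.single_eq_of_ne hki] at hk
        omega
    | succ n ih =>
      intro a ha i
      obtain ⟨k, hk, h⟩ := hsucc (n + 1) (a + Pi.single i 1) i (by simp)
      rcases eq_or_ne k i with rfl | hki
      · rw [h, add_tsub_cancel_right]
      · have hak : 0 < a k := by simpa [hki] using hk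
        obtain ⟨b, hab⟩ : ∃ b : Fin d → ℕ, a = b + (Pi.single k 1 : Fin d → ℕ) :=
          ⟨_, exists_eq_add_single hak⟩
        rw [hab, sum_add_single] at ha
        have hb : ∑ j, b j = n := by omega
        have h1 : a + Pi.single i 1 - Pi.single k 1 = b + Pi.single i 1 := by
          rw [hab, add_right_comm, add_tsub_cancel_right]
        rw [h, h1, ih b hb i, hab, ih b hb k]
        have := hg i k b
        linarith
  refine ⟨fun a => pathSum g (∑ j, a j) a, fun i a => ?_⟩
  simp only [sum_add_single]
  exact key _ a rfl i

theorem exists_isRelLength (hS : HasGoodProperties S) (hE : HasGoodProperties E)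
    (c : Fin d → ℕ) : ∃ f, IsRelLength S E c f := by
  obtain ⟨r, hr⟩ := exists_potential (fun i a => jump S i a - jump E i a) fun i j a => by
    have h1 := jump_add_jump_comm hS i j a
    have h2 := jump_add_jump_comm hE i j a
    linarith
  exact ⟨fun a => r c - r a, fun i a => by rw [hr i a]; ring, by simp⟩

namespace IsRelLength

theorem eq_of_jump (hf : IsRelLength S E c f) {i : Fin d} {a : Fin d → ℕ}
    (hS : Jump S i a) (hE : Jump E i a) : f (a + Pi.single i 1) = f a := by
  rw [hf.step i a, jump_of_jump hS, jump_of_jump hE]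
  ring

theorem eq_of_not_jump (hf : IsRelLength S E c f) (hES : E ⊆ S) {i : Fin d} {a : Fin d → ℕ}
    (hS : ¬ Jump S i a) : f (a + Pi.single i 1) = f a := by
  rw [hf.step i a, jump_of_not_jump hS, jump_of_not_jump fun h => hS (h.mono hES)]
  ring

theorem add_one_eq (hf : IsRelLength S E c f) {i : Fin d} {a : Fin d → ℕ}
    (hS : Jump S i a) (hE : ¬ Jump E i a) : f (a + Pi.single i 1) + 1 = f a := by
  rw [hf.step i a, jump_of_jump hS, jump_of_not_jump hE]
  ring

theorem step_bounds (hf : IsRelLength S E c f) (hES : E ⊆ S) (i : Fin d) (a : Fin d → ℕ) :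
    f (a + Pi.single i 1) ≤ f a ∧ f a ≤ f (a + Pi.single i 1) + 1 := by
  by_cases hS : Jump S i a
  · by_cases hE : Jump E i a
    · have := hf.eq_of_jump hS hE
      omega
    · have := hf.add_one_eq hS hE
      omega
  · have := hf.eq_of_not_jump hES hS
    omega

end IsRelLength

/-- Induction along a path of unit steps from `a` up to `b`. -/
theorem step_induction {P : (Fin d → ℕ) → Prop} {a b : Fin d → ℕ} (hab : a ≤ b) (ha : P a)
    (step : ∀ x i, a ≤ x → x + Pi.single i 1 ≤ b → P x → P (x + Pi.single i 1)) : P b := by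
  obtain ⟨n, hn⟩ : ∃ n, ∑ j, (b j - a j) = n := ⟨_, rfl⟩
  induction n generalizing b with
  | zero =>
    have : a = b := by
      funext j
      have h1 := Finset.sum_eq_zero_iff.1 hn j (Finset.mem_univ j)
      have h2 := apply_le_apply hab j
      omega
    exact this ▸ ha
  | succ n ih =>
    obtain ⟨i, hi⟩ : ∃ i, a i < b i := by
      by_contra hcon
      push Not at hcon
      have : ∑ j, (b j - a j) = 0 := Finset.sum_eq_zero fun j _ => by
        have := hcon j
        omega
      omega
    obtain ⟨x, rfl⟩ : ∃ x : Fin d → ℕ, b = x + (Pi.single i 1 : Fin d → ℕ) :=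
      ⟨_, exists_eq_add_single (Nat.zero_lt_of_lt hi)⟩
    have hax : a ≤ x := by
      intro j
      change a j ≤ x j
      rcases eq_or_ne j i with rfl | hj
      · simp only [Pi.add_apply, Pi.single_eq_same] at hi
        omega
      · simpa [hj] using hab j
    have hsum : ∑ j, (x j - a j) = n := by
      have : ∑ j, ((x + Pi.single i 1 : Fin d → ℕ) j - a j) = ∑ j, (x j - a j) + 1 := by
        rw [← sum_add_single (fun j => x j - a j) i]
        refine Finset.sum_congr rfl fun j _ => ?_
        have := apply_le_apply hax j
        simp only [Pi.add_apply]
        omega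
      omega
    refine step x i hax le_rfl (ih hax (fun y j hy hj => ?_) hsum)
    exact step y j hy (hj.trans fun k => by simp)

namespace IsRelLength

theorem antitone (hf : IsRelLength S E c f) (hES : E ⊆ S) : Antitone f := fun a _ hab =>
  step_induction (P := fun x => f x ≤ f a) hab le_rfl fun x i _ _ h =>
    (hf.step_bounds hES i x).1.trans h

/-- Beyond `c`, both `S` and `E` jump on every step, so that only the part of `a` below `c`
matters. -/
theorem apply_inf_conductor (hf : IsRelLength S E c f) (hES : E ⊆ S) (hc : ∀ x, c + x ∈ E)
    (a : Fin d → ℕ) : f (a ⊓ c) = f a := by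
  refine step_induction (P := fun x => f (a ⊓ c) = f x) inf_le_left rfl
    fun x i hx hxa h => ?_
  have h1 := apply_le_apply hx i
  have h2 := (add_single_le_iff.1 hxa).2
  simp only [Pi.inf_apply] at h1
  have hE : Jump E i x := .of_conductor_le hc (by omega)
  rw [hf.eq_of_jump (hE.mono hES) hE, h]

theorem apply_of_conductor_le (hf : IsRelLength S E c f) (hES : E ⊆ S) (hc : ∀ x, c + x ∈ E)
    {a : Fin d → ℕ} (h : c ≤ a) : f a = 0 := by
  rw [← hf.apply_inf_conductor hES hc, inf_eq_right.2 h, hf.apply_conductor]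

/-- Climbing from `p` along steps that preserve `f` and the invariant `R`, as long as `Q` fails,
ends at a point where `Q` holds, because each step reduces the distance to `c`. -/
theorem climb {Q R : (Fin d → ℕ) → Prop} (p : Fin d → ℕ) (hp : R p)
    (step : ∀ x, p ≤ x → f x = f p → R x → ¬ Q x →
      ∃ i, x i < c i ∧ f (x + Pi.single i 1) = f x ∧ R (x + Pi.single i 1)) :
    ∃ b, p ≤ b ∧ f b = f p ∧ R b ∧ Q b := by
  have key : ∀ n : ℕ, ∀ x, ∑ j, (c j - x j) = n → p ≤ x → f x = f p → R x →
      ∃ b, p ≤ b ∧ f b = f p ∧ R b ∧ Q b := by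
    intro n
    induction n using Nat.strong_induction_on with
    | _ n ih =>
      intro x hn hpx hfx hR
      by_cases hQ : Q x
      · exact ⟨x, hpx, hfx, hR, hQ⟩
      · obtain ⟨i, hi, hfi, hRi⟩ := step x hpx hfx hR hQ
        refine ih _ ?_ _ rfl (hpx.trans fun j => by simp) (hfi.trans hfx) hRi
        rw [← hn]
        refine Finset.sum_lt_sum (fun j _ => ?_) ⟨i, Finset.mem_univ i, ?_⟩
        · simp only [Pi.add_apply]
          omega
        · simp only [Pi.add_apply, Pi.single_eq_same]
          omega
  exact key _ p rfl le_rfl rfl hp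

/-- The least element of `S` above `p` has the same relative length as `p`. -/
theorem exists_least_mem (hf : IsRelLength S E c f) (hS : HasGoodProperties S) (hES : E ⊆ S)
    (hc : ∀ x, c + x ∈ E) (p : Fin d → ℕ) :
    ∃ b ∈ S, p ≤ b ∧ f b = f p ∧ ∀ w ∈ S, p ≤ w → b ≤ w := by
  obtain ⟨b, h1, h2, h3, h4⟩ := climb (f := f) (c := c) (Q := fun x => x ∈ S)
    (R := fun x => ∀ w ∈ S, p ≤ w → x ≤ w) p (fun w _ h => h) fun x _ _ hR hQ => by
      obtain ⟨i, hi⟩ : ∃ i, ¬ Jump S i x := by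
        by_contra hcon
        push Not at hcon
        exact hQ (mem_of_forall_jump hS hcon)
      refine ⟨i, ?_, hf.eq_of_not_jump hES hi, fun w hw hpw => ?_⟩
      · by_contra h
        exact hi (.of_conductor_le (fun x => hES (hc x)) (not_lt.1 h))
      · refine add_single_le_iff.2 ⟨hR w hw hpw, lt_of_le_of_ne (hR w hw hpw i) fun h => ?_⟩
        exact hi ⟨w, hw, hR w hw hpw, h.symm⟩
  exact ⟨b, h4, h1, h2, h3⟩

/-- Above a point of positive relative length there is an element of `S \ E` with the same relative
length: both at a point outside `S` and at a point of `E` some step preserves the length. -/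
theorem exists_mem_diff (hf : IsRelLength S E c f) (hS : HasGoodProperties S) (hES : E ⊆ S)
    (hc : ∀ x, c + x ∈ E) (p : Fin d → ℕ) (hp : 0 < f p) :
    ∃ b ∈ S \ E, p ≤ b ∧ f b = f p := by
  obtain ⟨b, h1, h2, -, h4⟩ := climb (f := f) (c := c) (Q := fun x => x ∈ S \ E)
    (R := fun _ => True) p trivial fun x _ hfx _ hQ => by
      by_cases hxE : x ∈ E
      · obtain ⟨i, hi⟩ : ∃ i, x i < c i := by
          by_contra hcon
          push Not at hcon
          have := hf.apply_of_conductor_le hES hc hcon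
          omega
        exact ⟨i, hi, hf.eq_of_jump (.of_mem (hES hxE) i) (.of_mem hxE i), trivial⟩
      · obtain ⟨i, hi⟩ : ∃ i, ¬ Jump S i x := by
          by_contra hcon
          push Not at hcon
          exact hQ ⟨mem_of_forall_jump hS hcon, hxE⟩
        refine ⟨i, ?_, hf.eq_of_not_jump hES hi, trivial⟩
        by_contra h
        exact hi (.of_conductor_le (fun x => hES (hc x)) (not_lt.1 h))
  exact ⟨b, h4, h1, h2⟩

theorem exists_step_drop (hf : IsRelLength S E c f) (hE : HasGoodProperties E)
    {a : Fin d → ℕ} (ha : a ∈ S \ E) :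
    ∃ i, ¬ Jump E i a ∧ f (a + Pi.single i 1) + 1 = f a := by
  obtain ⟨i, hi⟩ : ∃ i, ¬ Jump E i a := by
    by_contra hcon
    push Not at hcon
    exact ha.2 (mem_of_forall_jump hE hcon)
  exact ⟨i, hi, hf.add_one_eq (.of_mem ha.1 i) hi⟩

theorem pos (hf : IsRelLength S E c f) (hE : HasGoodProperties E) (hES : E ⊆ S)
    (hc : ∀ x, c + x ∈ E) {a : Fin d → ℕ} (ha : a ∈ S \ E) : 0 < f a := by
  obtain ⟨i, -, hi⟩ := hf.exists_step_drop hE ha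
  have h1 := hf.antitone hES
    (show a + Pi.single i 1 ≤ (a + Pi.single i 1) ⊔ c from le_sup_left)
  have h2 := hf.apply_of_conductor_le hES hc
    (show c ≤ (a + Pi.single i 1) ⊔ c from le_sup_right)
  omega

end IsRelLength

/-! ### The layers are the level sets of the relative length -/

variable {M : AddSubmonoid (Fin d → ℕ)}

/-- Let `X` be the set of elements of `S \ E` of relative length at least `m > 0`. If `a ∈ X` has
length more than `m`, but nothing in `X` strictly dominates `a`, then `a` is a complete infimum of
elements of `X` that are not strictly dominated in `X` either. Choose `i₀`
such that `E` does not jump at `a` in direction `i₀`. One of the parts is an element `b` of `S \ E`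
above `a + e_{i₀}` of the same relative length; the others are the least elements of `S` above
`a + e_i`, for `i` with `b_i = a_i`. These are not in `E` by the choice of `i₀`, and by (G2) the
sets of components in which the parts exceed `a` form a partition. -/
theorem mem_infPart_of_lt (hf : IsRelLength (M : Set (Fin d → ℕ)) E c f) (hM : IsGoodSemigroup M)
    (hE : HasGoodProperties E) (hES : E ⊆ M) (hc : ∀ x, c + x ∈ E) {X : Set (Fin d → ℕ)}
    {m : ℤ} (hm : 0 < m) (hX : ∀ a, a ∈ X ↔ a ∈ (M : Set (Fin d → ℕ)) \ E ∧ m ≤ f a)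
    {a : Fin d → ℕ} (ha : a ∈ maxPart X) (hfa : m < f a) : a ∈ infPart M X := by
  have haA := ((hX a).1 ha.1).1
  -- Elements of `X` above `a` inherit from `a` that nothing in `X` strictly dominates them.
  have hmax : ∀ b ∈ X, a ≤ b → b ∈ maxPart X := by
    refine fun b hb hab => ⟨hb, fun w hw hbw => hbw.resolve_right fun hlt => ?_⟩
    have hlt' : ∀ i, a i < w i := fun i => (apply_le_apply hab i).trans_lt (hlt i)
    have haw := ha.2 w hw (Or.inr hlt')
    obtain ⟨i, -⟩ := hf.exists_step_drop hE haA
    have := hlt' i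
    rw [← haw] at this
    omega
  obtain ⟨i₀, hi₀, hdrop⟩ := hf.exists_step_drop hE haA
  obtain ⟨b, hbA, hab, hfb⟩ := hf.exists_mem_diff hM hES hc (a + Pi.single i₀ 1) (by omega)
  obtain ⟨hab, hbi₀⟩ := add_single_le_iff.1 hab
  have hbX : b ∈ X := (hX b).2 ⟨hbA, by omega⟩
  obtain ⟨i₁, hi₁⟩ : ∃ i, b i = a i := by
    by_contra hcon
    push Not at hcon
    have h := ha.2 b hbX (Or.inr fun i => lt_of_le_of_ne (apply_le_apply hab i) (hcon i).symm)
    rw [← h] at hbi₀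
    omega
  choose β hβM hβa hfβ hβmin using fun i =>
    hf.exists_least_mem hM hES hc (a + Pi.single i 1)
  -- (G2): the least element above `a + e_i` agrees with `a` wherever `w` exceeds `a`.
  have hsep : ∀ w ∈ M, a ≤ w → w ≠ a → ∀ i, w i = a i → ∀ j, a j < w j → β i j = a j := by
    intro w hw haw hne i hi j hj
    obtain ⟨e, he, hei, hej⟩ := hM.exists_lt a haA.1 w hw hne.symm i hi.symm
    have hle : a ≤ e := by
      intro k
      change a k ≤ e k
      rcases eq_or_ne k i with rfl | hk
      · exact hei.le
      · have h1 := apply_le_apply haw k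
        have h2 := (hej k hk).1
        omega
    have h1 := apply_le_apply (hβmin i e he (add_single_le_iff.2 ⟨hle, hei⟩)) j
    have h2 := (hej j (by rintro rfl; omega)).2 (by omega)
    have h3 := apply_le_apply (add_single_le_iff.1 (hβa i)).1 j
    omega
  have hβle : ∀ i, a ≤ β i := fun i => (add_single_le_iff.1 (hβa i)).1
  have hβlt : ∀ i, a i < β i i := fun i => (add_single_le_iff.1 (hβa i)).2
  have hβne : ∀ i, β i ≠ a := fun i h => by
    have := hβlt i
    rw [h] at this
    omega
  have hbne : b ≠ a := fun h => by
    rw [h] at hbi₀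
    omega
  have hβi₀ : ∀ i, b i = a i → β i i₀ = a i₀ := fun i hi =>
    hsep b hbA.1 hab hbne i hi i₀ hbi₀
  have hβX : ∀ i, b i = a i → β i ∈ X := by
    refine fun i hi => (hX _).2 ⟨⟨hβM i, fun h => hi₀ ⟨β i, h, hβle i, hβi₀ i hi⟩⟩, ?_⟩
    have := (hf.step_bounds hES i a).2
    rw [hfβ]
    omega
  -- Two of the least elements that exceed `a` in a common component coincide.
  have hβsub : ∀ i j, a j < β i j → β j ≤ β i := fun i j h =>
    hβmin j (β i) (hβM i) (add_single_le_iff.2 ⟨hβle i, h⟩)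
  have hβeq : ∀ i j, a j < β i j → β i = β j := by
    intro i j h
    refine le_antisymm (hβsub j i (lt_of_le_of_ne (hβle j i) fun hij => ?_)) (hβsub i j h)
    have := hsep (β j) (hβM j) (hβle j) (hβne j) i hij.symm j (hβlt j)
    omega
  classical
  let φ : Fin d → Fin d → ℕ := fun i => if b i = a i then β i else b
  have hφX : ∀ i, φ i ∈ X := by
    intro i
    by_cases hi : b i = a i
    · simpa only [φ, if_pos hi] using hβX i hi
    · simpa only [φ, if_neg hi] using hbX
  have hφle : ∀ i, a ≤ φ i := by
    intro i
    by_cases hi : b i = a i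
    · simpa only [φ, if_pos hi] using hβle i
    · simpa only [φ, if_neg hi] using hab
  have hφlt : ∀ i, a i < φ i i := by
    intro i
    by_cases hi : b i = a i
    · simpa only [φ, if_pos hi] using hβlt i
    · simpa only [φ, if_neg hi] using lt_of_le_of_ne (apply_le_apply hab i) (Ne.symm hi)
  have hφeq : ∀ i, ∃ j, φ i j = a j := by
    intro i
    by_cases hi : b i = a i
    · exact ⟨i₀, by simpa only [φ, if_pos hi] using hβi₀ i hi⟩
    · exact ⟨i₁, by simpa only [φ, if_neg hi] using hi₁⟩
  have hφinf : ∀ i j, φ i ≠ φ j → a = φ i ⊓ φ j := by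
    intro i j hne
    funext k
    by_contra hk
    have h1 := apply_le_apply (hφle i) k
    have h2 := apply_le_apply (hφle j) k
    simp only [Pi.inf_apply] at hk
    have h3 : a k < φ i k := by omega
    have h4 : a k < φ j k := by omega
    have hbβ : ∀ l, b l = a l → a k < b k → ¬ a k < β l k := fun l hl hbk h => by
      have := hsep b hbA.1 hab hbne l hl k hbk
      omega
    by_cases hi : b i = a i <;> by_cases hj : b j = a j
    · simp only [φ, if_pos hi, if_pos hj] at hne h3 h4
      exact hne ((hβeq i k h3).trans (hβeq j k h4).symm)
    · simp only [φ, if_pos hi, if_neg hj] at h3 h4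
      exact hbβ i hi h4 h3
    · simp only [φ, if_neg hi, if_pos hj] at h3 h4
      exact hbβ j hj h3 h4
    · simp only [φ, if_neg hi, if_neg hj] at hne
      exact hne rfl
  -- The parts are numbered by an enumeration of the values of `φ`, of which there are at most `d`.
  let T : Finset (Fin d → ℕ) := Finset.univ.image φ
  have hT : ∀ x ∈ T, ∃ i, φ i = x := fun x hx => by simpa [T] using hx
  have hφT : ∀ i, φ i ∈ T := fun i => Finset.mem_image_of_mem φ (Finset.mem_univ i)
  have hcard : 1 < T.card := by
    refine Finset.one_lt_card.2 ⟨φ i₀, hφT i₀, φ i₁, hφT i₁, fun h => ?_⟩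
    have h1 := hφlt i₀
    have h2 := hβi₀ i₁ hi₁
    rw [h] at h1
    simp only [φ, if_pos hi₁] at h1
    omega
  refine ⟨ha, T.card, hcard, ?_, fun k => (T.equivFin.symm k : Fin d → ℕ), fun k => ?_, hcard,
    fun k => {j | (T.equivFin.symm k : Fin d → ℕ) j = a j}, fun k => ?_, fun j k hjk => ?_, ?_⟩
  · simpa [T] using Finset.card_image_le (s := Finset.univ) (f := φ)
  · obtain ⟨i, hi⟩ := hT _ (T.equivFin.symm k).2
    beta_reduce
    rw [← hi]
    exact hmax _ (hφX i) (hφle i)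
  · obtain ⟨i, hi⟩ := hT _ (T.equivFin.symm k).2
    beta_reduce
    rw [← hi]
    refine ⟨hφeq i, fun h => ?_, ((hX _).1 (hφX i)).1.1, fun j hj => ?_, fun j hj => ?_⟩
    · have h1 : φ i i = a i := (Set.ext_iff.1 h i).2 trivial
      have h2 := hφlt i
      omega
    · exact congrArg Nat.cast hj
    · exact Nat.cast_lt.2 (lt_of_le_of_ne (hφle i j) (Ne.symm hj))
  · obtain ⟨i, hi⟩ := hT _ (T.equivFin.symm j).2
    obtain ⟨l, hl⟩ := hT _ (T.equivFin.symm k).2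
    have hne : (T.equivFin.symm j : Fin d → ℕ) ≠ T.equivFin.symm k := fun h =>
      hjk (T.equivFin.symm.injective (Subtype.ext h))
    beta_reduce
    rw [← hi, ← hl] at hne ⊢
    exact hφinf i l hne
  · refine Set.eq_empty_iff_forall_notMem.2 fun i hi => ?_
    have h1 := Set.mem_iInter.1 hi (T.equivFin ⟨φ i, hφT i⟩)
    simp only [Equiv.symm_apply_apply, Set.mem_ofPred_eq] at h1
    have h2 := hφlt i
    omega

/-- If `m` is a lower bound of the relative length on `X`, then an element of `X` of length `m` is
undominated and not a complete infimum: by `exists_step_drop` there is a direction in which every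
step up from `a` brings the length below `m`, and both an element that strictly dominates `a` and
some part of a complete infimum exceed `a` in that direction. -/
theorem mem_maxPart_diff_infPart_of_eq (hf : IsRelLength (M : Set (Fin d → ℕ)) E c f)
    (hE : HasGoodProperties E) (hES : E ⊆ M) {X : Set (Fin d → ℕ)} {m : ℤ}
    (hX : ∀ a, a ∈ X ↔ a ∈ (M : Set (Fin d → ℕ)) \ E ∧ m ≤ f a)
    {a : Fin d → ℕ} (ha : a ∈ X) (hfa : f a = m) : a ∈ maxPart X \ infPart M X := by
  obtain ⟨i, -, hi⟩ := hf.exists_step_drop hE ((hX a).1 ha).1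
  have key : ∀ b ∈ X, a ≤ b → a i < b i → False := by
    intro b hb hab hlt
    have h1 := hf.antitone hES (add_single_le_iff.2 ⟨hab, hlt⟩)
    have h2 := ((hX b).1 hb).2
    omega
  refine ⟨⟨ha, fun b hb hab => hab.resolve_right fun hlt => ?_⟩, ?_⟩
  · exact key b hb (fun j => (hlt j).le) (hlt i)
  · rintro ⟨-, r, -, -, b, hb, -, F, hF, -, hemp⟩
    have hiF : i ∉ ⋂ k, F k := by rw [hemp]; exact fun h => h
    obtain ⟨k, hk⟩ : ∃ k, i ∉ F k := by simpa using hiF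
    obtain ⟨-, -, -, h1, h2⟩ := hF k
    refine key (b k) (hb k).1 (fun j => ?_) (Nat.cast_lt.1 (h2 i hk))
    by_cases hj : j ∈ F k
    · exact (Nat.cast_injective (h1 j hj)).ge
    · exact (Nat.cast_lt.1 (h2 j hj)).le

theorem mem_residual_iff (hf : IsRelLength (M : Set (Fin d → ℕ)) E c f) (hM : IsGoodSemigroup M)
    (hE : HasGoodProperties E) (hES : E ⊆ M) (hc : ∀ x, c + x ∈ E) (n : ℕ) (a : Fin d → ℕ) :
    a ∈ residual M ((M : Set (Fin d → ℕ)) \ E) n ↔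
      a ∈ (M : Set (Fin d → ℕ)) \ E ∧ (n : ℤ) + 1 ≤ f a := by
  induction n generalizing a with
  | zero =>
    refine ⟨fun h => ⟨h, ?_⟩, fun h => h.1⟩
    have := hf.pos hE hES hc h
    simp only [Nat.cast_zero]
    omega
  | succ n ih =>
    rw [residual, Set.mem_sdiff, ih]
    constructor
    · rintro ⟨⟨haA, hfa⟩, h⟩
      refine ⟨haA, ?_⟩
      by_contra hcon
      push_cast at hcon
      exact h (mem_maxPart_diff_infPart_of_eq hf hE hES ih ((ih a).2 ⟨haA, hfa⟩) (by omega))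
    · rintro ⟨haA, hfa⟩
      push_cast at hfa
      exact ⟨⟨haA, by omega⟩, fun h =>
        h.2 (mem_infPart_of_lt hf hM hE hES hc (by omega) ih h.1 (by omega))⟩

theorem mem_layer_iff (hf : IsRelLength (M : Set (Fin d → ℕ)) E c f) (hM : IsGoodSemigroup M)
    (hE : HasGoodProperties E) (hES : E ⊆ M) (hc : ∀ x, c + x ∈ E) {n : ℕ} (hn : 1 ≤ n)
    (a : Fin d → ℕ) :
    a ∈ layer M ((M : Set (Fin d → ℕ)) \ E) n ↔
      a ∈ (M : Set (Fin d → ℕ)) \ E ∧ f a = n := by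
  obtain ⟨n, rfl⟩ := Nat.exists_eq_add_of_le' hn
  have hres := mem_residual_iff hf hM hE hES hc n
  rw [layer, Nat.add_sub_cancel]
  push_cast
  constructor
  · intro h
    obtain ⟨haA, hfa⟩ := (hres a).1 h.1.1
    refine ⟨haA, le_antisymm (not_lt.1 fun hlt => h.2 ?_) hfa⟩
    exact mem_infPart_of_lt hf hM hE hES hc (by omega) hres h.1 hlt
  · rintro ⟨haA, hfa⟩
    exact mem_maxPart_diff_infPart_of_eq hf hE hES hres ((hres a).2 ⟨haA, hfa.ge⟩) hfa

theorem numLevels_eq (hf : IsRelLength (M : Set (Fin d → ℕ)) E c f) (hM : IsGoodSemigroup M)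
    (hE : IsGoodIdeal M E) (hc : ∀ x, c + x ∈ E) (h0 : (0 : Fin d → ℕ) ∉ E) :
    (numLevels M ((M : Set (Fin d → ℕ)) \ E) : ℤ) = f 0 := by
  have h0A : (0 : Fin d → ℕ) ∈ (M : Set (Fin d → ℕ)) \ E := ⟨M.zero_mem, h0⟩
  have hlayer := fun {n : ℕ} (hn : 1 ≤ n) => mem_layer_iff hf hM hE.good hE.subset hc hn
  obtain ⟨⟨hN1, hN⟩, hleast⟩ := numLevels_spec M hE
  have hpos := fun {a} (ha : a ∈ (M : Set (Fin d → ℕ)) \ E) => hf.pos hE.good hE.subset hc ha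
  apply le_antisymm
  · have hp := hpos h0A
    have : (f 0).toNat ∈ {n | 1 ≤ n ∧ (M : Set (Fin d → ℕ)) \ E =
        ⋃ j ∈ Set.Icc 1 n, layer M ((M : Set (Fin d → ℕ)) \ E) j} := by
      refine ⟨by omega, Set.Subset.antisymm (fun a ha => ?_)
        (Set.iUnion₂_subset fun j _ => layer_subset M _ j)⟩
      have h1 := hpos ha
      have h2 : f a ≤ f 0 := hf.antitone hE.subset fun j => Nat.zero_le _
      refine Set.mem_iUnion₂.2 ⟨(f a).toNat, ⟨by omega, by omega⟩, ?_⟩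
      exact (hlayer (by omega) a).2 ⟨ha, by omega⟩
    have := hleast this
    omega
  · rw [hN] at h0A
    obtain ⟨j, hj, h⟩ := Set.mem_iUnion₂.1 h0A
    have := ((hlayer hj.1 0).1 h).2
    have := hj.2
    omega

/-! ### Duality -/

theorem mem_delta_iff {X : Set (Fin d → ℕ)} {a b : Fin d → ℕ} :
    b ∈ delta X (gamma E - toInt a) ↔ b ∈ X ∧ ∃ i, a i + b i + 1 = conductor E i ∧
      ∀ j, j ≠ i → conductor E j ≤ a j + b j := by
  simp only [delta, deltaF, gamma, toInt, Set.mem_iUnion, Set.mem_ofPred_eq,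
    Set.mem_singleton_iff, forall_eq, Pi.sub_apply]
  constructor
  · rintro ⟨i, hb, hi, hj⟩
    refine ⟨hb, i, by omega, fun j hji => ?_⟩
    have := hj j hji
    omega
  · rintro ⟨hb, i, hi, hj⟩
    refine ⟨i, hb, by omega, fun j hji => ?_⟩
    have := hj j hji
    omega

/-- `E` is the canonical dual of `S` with respect to `c`: a point lies in `E` if and only if no
element of `S` lies in `Δ(c - (1, …, 1) - a)`, written out with natural numbers. -/
def IsDual (S E : Set (Fin d → ℕ)) (c : Fin d → ℕ) : Prop :=
  ∀ a, a ∈ E ↔ ∀ b ∈ S, ∀ i, a i + b i + 1 = c i → ∃ j, j ≠ i ∧ a j + b j < c j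

/-- Duality of jumps: on the step from `a` to `a + e_i`, the set `E` jumps if and only if `S` does
not jump on the opposite step, from `c - a - e_i` to `c - a`. -/
theorem jump_iff_not_jump (hS : HasGoodProperties S) (hdual : IsDual S E c)
    {a : Fin d → ℕ} (hac : a ≤ c) {i : Fin d} (hi : a i < c i) :
    Jump E i a ↔ ¬ Jump S i (c - (a + Pi.single i 1)) := by
  -- The witnesses for the jump of `S` are the elements of `Δ_i(c - (1, …, 1) - a)`.
  have hwit : ∀ w : Fin d → ℕ, c - (a + Pi.single i 1) ≤ w ∧
      w i = (c - (a + Pi.single i 1) : Fin d → ℕ) i ↔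
      a i + w i + 1 = c i ∧ ∀ j, j ≠ i → c j ≤ a j + w j := by
    intro w
    constructor
    · rintro ⟨h1, h2⟩
      simp only [Pi.sub_apply, Pi.add_apply, Pi.single_eq_same] at h2
      refine ⟨by omega, fun j hj => ?_⟩
      have := h1 j
      simp only [Pi.sub_apply, Pi.add_apply, Pi.single_eq_of_ne hj] at this
      omega
    · rintro ⟨h1, h2⟩
      refine ⟨fun j => ?_, ?_⟩
      · rcases eq_or_ne j i with rfl | hj
        · simp only [Pi.sub_apply, Pi.add_apply, Pi.single_eq_same]
          omega
        · have := h2 j hj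
          simp only [Pi.sub_apply, Pi.add_apply, Pi.single_eq_of_ne hj]
          omega
      · simp only [Pi.sub_apply, Pi.add_apply, Pi.single_eq_same]
        omega
  constructor
  · rintro ⟨b, hb, hab, hbi⟩ ⟨w, hw, hw'⟩
    obtain ⟨h1, h2⟩ := (hwit w).1 hw'
    obtain ⟨j, hj, hlt⟩ := (hdual b).1 hb w hw i (by omega)
    have := h2 j hj
    have := apply_le_apply hab j
    omega
  · intro hno
    -- A point of `E` is found as a maximal `b` in the box with no witness at index `i`.
    let P : Set (Fin d → ℕ) := {b | a ≤ b ∧ b ≤ c ∧ b i = a i ∧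
      ∀ w ∈ S, a i + w i + 1 = c i → ∃ j, j ≠ i ∧ b j + w j < c j}
    have hPfin : P.Finite := (Set.finite_Icc a c).subset fun b hb => ⟨hb.1, hb.2.1⟩
    have haP : a ∈ P := by
      refine ⟨le_rfl, hac, rfl, fun w hw h => ?_⟩
      by_contra hcon
      push Not at hcon
      exact hno ⟨w, hw, (hwit w).2 ⟨h, hcon⟩⟩
    obtain ⟨b, hbmax⟩ := hPfin.exists_maximal ⟨a, haP⟩
    obtain ⟨hab, hbc, hbi, hbw⟩ := hbmax.prop
    refine ⟨b, (hdual b).2 fun w hw j hwj => ?_, hab, hbi⟩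
    rcases eq_or_ne j i with rfl | hji
    · exact hbw w hw (by omega)
    · by_contra hcon
      push Not at hcon
      have hb' : b + Pi.single j 1 ∉ P := fun h => by
        have h1 := apply_le_apply (hbmax.le_of_ge h fun k => by simp) j
        simp only [Pi.add_apply, Pi.single_eq_same] at h1
        omega
      obtain ⟨t, ht, hti, htk⟩ : ∃ t ∈ S, a i + t i + 1 = c i ∧
          ∀ k, k ≠ i → c k ≤ (b + Pi.single j 1 : Fin d → ℕ) k + t k := by
        by_contra hno'
        push Not at hno'
        refine hb' ⟨hab.trans fun k => by simp, add_single_le_iff.2 ⟨hbc, by omega⟩,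
          by simpa [hji.symm] using hbi, hno'⟩
      obtain ⟨l, hli, hl⟩ := hbw t ht hti
      have htk' : ∀ k, k ≠ i → k ≠ j → c k ≤ b k + t k := fun k hk hkj => by
        simpa [hkj] using htk k hk
      obtain rfl : l = j := by
        by_contra hlj
        have := htk' l hli hlj
        omega
      have htl := htk l hli
      simp only [Pi.add_apply, Pi.single_eq_same] at htl
      -- `t` and `w` agree at `l`, and (G2) yields a witness for `b` at index `i`.
      have hwi := hcon i hji.symm
      obtain ⟨e, he, hel, hek⟩ := hS.exists_lt t ht w hw
        (fun h => by rw [h] at hti; omega) l (by omega)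
      have hei := (hek i hji.symm).2 (by omega)
      obtain ⟨k, hki, hk⟩ := hbw e he (by omega)
      rcases eq_or_ne k l with rfl | hkl
      · omega
      · have h1 := (hek k hkl).1
        have h2 := htk' k hki hkl
        have h3 := hcon k hkl
        omega

/-- The relative lengths at opposite points of the box add up to the relative length at `0`. -/
theorem IsRelLength.add_apply_sub (hf : IsRelLength S E c f) (hS : HasGoodProperties S)
    (hdual : IsDual S E c) {a : Fin d → ℕ} (hac : a ≤ c) : f a + f (c - a) = f 0 := by
  refine step_induction (P := fun a => f a + f (c - a) = f 0) (zero_le : 0 ≤ a)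
    (by simp [hf.apply_conductor]) fun x i _ hx h => ?_
  have hxc := hx.trans hac
  obtain ⟨hle, hlt⟩ := add_single_le_iff.1 hxc
  set y := c - (x + Pi.single i 1) with hy
  have hxy : c - (y + Pi.single i 1) = x := by
    funext j
    have := apply_le_apply hle j
    rcases eq_or_ne j i with rfl | hj
    · simp only [hy, Pi.sub_apply, Pi.add_apply, Pi.single_eq_same]
      omega
    · simp only [hy, Pi.sub_apply, Pi.add_apply, Pi.single_eq_of_ne hj]
      omega
  have hyx : y + Pi.single i 1 = c - x := by
    funext j
    have := apply_le_apply hle j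
    rcases eq_or_ne j i with rfl | hj
    · simp only [hy, Pi.sub_apply, Pi.add_apply, Pi.single_eq_same]
      omega
    · simp only [hy, Pi.sub_apply, Pi.add_apply, Pi.single_eq_of_ne hj]
      omega
  have hyc : y ≤ c := fun j => by simp [hy]
  have hyi : y i < c i := by
    simp only [hy, Pi.sub_apply, Pi.add_apply, Pi.single_eq_same]
    omega
  have h1 := jump_iff_not_jump hS hdual hle hlt
  have h2 := jump_iff_not_jump hS hdual hyc hyi
  rw [← hy] at h1
  rw [hxy] at h2
  have h3 := hf.step i x
  have h4 := hf.step i y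
  rw [hyx] at h4
  have h5 : jump S i x - jump E i x = jump S i y - jump E i y := by
    unfold jump
    by_cases hSx : Jump S i x <;> by_cases hSy : Jump S i y <;> simp [h1, h2, hSx, hSy]
  omega

/-- If `b` lies in `Δ(c - (1, …, 1) - a)`, then it lies above `c - a - e_i`, where `a` may be
truncated at `c`, and this point has relative length at most `f 0 - f a + 1`. -/
theorem IsRelLength.add_le (hf : IsRelLength S E c f) (hS : HasGoodProperties S) (hES : E ⊆ S)
    (hdual : IsDual S E c) {a b : Fin d → ℕ} {i : Fin d} (hi : a i + b i + 1 = c i)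
    (hj : ∀ j, j ≠ i → c j ≤ a j + b j) : f a + f b ≤ f 0 + 1 := by
  have h1 := hf.add_apply_sub hS hdual (a := a ⊓ c) inf_le_right
  have h2 : f a ≤ f (a ⊓ c) := hf.antitone hES inf_le_left
  have h3 : f (b + Pi.single i 1) ≤ f (c - a ⊓ c) := by
    refine hf.antitone hES fun j => ?_
    rcases eq_or_ne j i with rfl | hji
    · simp only [Pi.sub_apply, Pi.inf_apply, Pi.add_apply, Pi.single_eq_same]
      omega
    · have := hj j hji
      simp only [Pi.sub_apply, Pi.inf_apply, Pi.add_apply, Pi.single_eq_of_ne hji]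
      omega
  have h4 := (hf.step_bounds hES i b).2
  omega

/-- The bound of `add_le` is attained for every `a ∈ S \ E`: `E` does not jump at the truncation of
`a` in some direction `i`, and the least element of `S` above `c - a - e_i` attains it. -/
theorem IsRelLength.exists_add_eq (hf : IsRelLength S E c f) (hS : HasGoodProperties S)
    (hE : HasGoodProperties E) (hES : E ⊆ S) (hc : ∀ x, c + x ∈ E) (hdual : IsDual S E c)
    {a : Fin d → ℕ} (ha : a ∈ S \ E) :
    ∃ b ∈ S, (∃ i, a i + b i + 1 = c i ∧ ∀ j, j ≠ i → c j ≤ a j + b j) ∧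
      f a + f b = f 0 + 1 := by
  have hacE : a ⊓ c ∉ E := by
    intro h
    refine ha.2 ((hdual a).2 fun b hb i hi => ?_)
    obtain ⟨j, hj, hlt⟩ := (hdual _).1 h b hb i (by simp only [Pi.inf_apply]; omega)
    simp only [Pi.inf_apply] at hlt
    exact ⟨j, hj, by omega⟩
  obtain ⟨i, hEi⟩ : ∃ i, ¬ Jump E i (a ⊓ c) := by
    by_contra hcon
    push Not at hcon
    exact hacE (mem_of_forall_jump hE hcon)
  have hi : (a ⊓ c) i < c i := by
    by_contra h
    exact hEi (.of_conductor_le hc (not_lt.1 h))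
  have hai : (a ⊓ c) i = a i := by
    simp only [Pi.inf_apply] at hi ⊢
    omega
  have hSi : Jump S i (a ⊓ c) := ⟨a, ha.1, inf_le_left, hai.symm⟩
  have hdrop := hf.add_one_eq hSi hEi
  obtain ⟨w, hw, hpw, hwi⟩ : Jump S i (c - (a ⊓ c + Pi.single i 1)) := by
    by_contra h
    exact hEi ((jump_iff_not_jump hS hdual inf_le_right hi).2 h)
  obtain ⟨b, hb, hpb, hfb, hmin⟩ :=
    hf.exists_least_mem hS hES hc (c - (a ⊓ c + Pi.single i 1))
  have hsum := hf.add_apply_sub hS hdual (a := a ⊓ c + Pi.single i 1)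
    (add_single_le_iff.2 ⟨inf_le_right, hi⟩)
  have hfa := hf.apply_inf_conductor hES hc a
  refine ⟨b, hb, ⟨i, ?_, fun j hj => ?_⟩, by omega⟩
  · have h1 := apply_le_apply hpb i
    have h2 := apply_le_apply (hmin w hw hpw) i
    simp only [Pi.sub_apply, Pi.add_apply, Pi.single_eq_same, hai] at h1 hwi hi
    omega
  · have h1 := apply_le_apply hpb j
    simp only [Pi.sub_apply, Pi.add_apply, Pi.inf_apply, Pi.single_eq_of_ne hj] at h1
    omega

theorem IsSymmetricComplement.isDual (hA : IsSymmetricComplement M E) :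
    IsDual (M : Set (Fin d → ℕ)) E (conductor E) := by
  intro a
  rw [hA.mem_ideal_iff, Set.eq_empty_iff_forall_notMem]
  simp only [mem_delta_iff, not_and, not_exists, not_forall, not_le, exists_prop]

/-! ### Dual levels -/

theorem dualLevel_eq_level (hM : IsGoodSemigroup M) (hE : IsGoodIdeal M E)
    (hA : IsSymmetricComplement M E) {i : ℕ} (h1 : 1 ≤ i)
    (hiN : i ≤ numLevels M ((M : Set (Fin d → ℕ)) \ E)) :
    dualLevel M E i = level M E (numLevels M ((M : Set (Fin d → ℕ)) \ E) - i + 1) := by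
  have hc : ∀ x, conductor E + x ∈ E := (conductor_isLeast hE.good).1
  have hdual := hA.isDual
  obtain ⟨f, hf⟩ := exists_isRelLength hM hE.good (conductor E)
  have h0 : (0 : Fin d → ℕ) ∉ E := by
    have h : (0 : Fin d → ℕ) ∈ level M E 1 := by
      rw [hA.level_one]
      rfl
    exact (layer_subset _ _ _ h).2
  have hN := numLevels_eq hf hM hE hc h0
  set N := numLevels M ((M : Set (Fin d → ℕ)) \ E) with hNdef
  have hlevel : ∀ j, 1 ≤ j → j ≤ N → ∀ a, a ∈ level M E j ↔
      a ∈ (M : Set (Fin d → ℕ)) \ E ∧ f a + j = N + 1 := by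
    intro j hj1 hjN a
    rw [level, ← hNdef, mem_layer_iff hf hM hE.good hE.subset hc (by omega)]
    exact and_congr_right fun _ => by omega
  have hle : ∀ a b, b ∈ delta (M : Set (Fin d → ℕ)) (gamma E - toInt a) → f a + f b ≤ N + 1 := by
    intro a b hab
    obtain ⟨-, k, hk, hkj⟩ := mem_delta_iff.1 hab
    have := hf.add_le hM hE.subset hdual hk hkj
    omega
  -- The relation `b ∈ Δ(γ - a)` is symmetric on `S \ E`, so the bound is attained from either side.
  have hattained : ∀ b ∈ (M : Set (Fin d → ℕ)) \ E, ∃ a ∈ (M : Set (Fin d → ℕ)) \ E,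
      b ∈ delta (M : Set (Fin d → ℕ)) (gamma E - toInt a) ∧ f a + f b = N + 1 := by
    intro b hb
    obtain ⟨a, ha, ⟨k, hk, hkj⟩, hab⟩ :=
      hf.exists_add_eq hM hE.good hE.subset hc hdual hb
    refine ⟨a, ((hA.mem_compl_iff b).1 hb).1 (mem_delta_iff.2 ⟨ha, k, hk, hkj⟩),
      mem_delta_iff.2 ⟨hb.1, k, by omega, fun j hj => ?_⟩, by omega⟩
    have := hkj j hj
    omega
  ext b
  rw [hlevel _ (by omega) (by omega)]
  simp only [dualLevel, Set.mem_sdiff, Set.mem_iUnion, Set.mem_Ico, exists_prop, not_exists,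
    not_and]
  constructor
  · rintro ⟨⟨w, hw, hbw⟩, hno⟩
    obtain ⟨hwA, hfw⟩ := (hlevel i h1 hiN w).1 hw
    have hbA : b ∈ (M : Set (Fin d → ℕ)) \ E := ((hA.mem_compl_iff w).1 hwA).1 hbw
    refine ⟨hbA, ?_⟩
    have hwb := hle w b hbw
    obtain ⟨a, haA, hba, hab⟩ := hattained b hbA
    have hpos := hf.pos hE.good hE.subset hc hbA
    by_contra hne
    refine hno (f b).toNat ⟨by omega, by omega⟩ a ?_ hba
    exact (hlevel _ (by omega) (by omega) a).2 ⟨haA, by omega⟩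
  · rintro ⟨hbA, hfb⟩
    obtain ⟨a, haA, hba, hab⟩ := hattained b hbA
    refine ⟨⟨a, (hlevel i h1 hiN a).2 ⟨haA, by omega⟩, hba⟩, fun j hj w hw hbw => ?_⟩
    have hfw := ((hlevel j hj.1 (by omega) w).1 hw).2
    have := hle w b hbw
    omega

end GoodSemigroup

theorem mainTheorem3 {d : ℕ} (S : AddSubmonoid (Fin d → ℕ))
    (hS : GoodSemigroup.IsGoodSemigroup S) (E : Set (Fin d → ℕ))
    (hE : GoodSemigroup.IsGoodIdeal S E) (hA : GoodSemigroup.IsSymmetricComplement S E) :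
    ∀ i : ℕ, 1 ≤ i → i ≤ GoodSemigroup.numLevels S ((S : Set (Fin d → ℕ)) \ E) →
      GoodSemigroup.dualLevel S E i =
        GoodSemigroup.level S E
          (GoodSemigroup.numLevels S ((S : Set (Fin d → ℕ)) \ E) - i + 1) := fun _ h1 hN =>
  GoodSemigroup.dualLevel_eq_level hS hE hA h1 hN
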